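/- Let $\ln$ denote the principal branch of the complex logarithm, and consider, for complex-valued functions $\phi(x,t)$ of two real variables, the equation $$\frac{\partial \phi}{\partial t}+\left(\frac{\partial \phi}{\partial x}\right)^3+3\,\frac{\partial \phi}{\partial x}\frac{\partial^2 \phi}{\partial x^2}+\frac{\partial^3 \phi}{\partial x^3}-6\,e^{\phi}\,\frac{\partial \phi}{\partial x}=0. \qquad (*)$$ A classical solution on an open set $\Omega\subseteq\mathbb R^2$ is a $C^3$ function on $\Omega$ that satisfies the equation at every point of $\Omega$. (0) Equation $(*)$ is the transform of the Korteweg--de Vries equation $u_t+u_{xxx}-6uu_x=0$ under $u=e^{\phi}$: a $C^3$ function $\phi:\Omega\to\mathbb C$ on an open set $\Omega\subseteq\mathbb R^2$ is a classical solution of $(*)$ if and only if $u=e^{\phi}$ is a classical solution of the Korteweg--de Vries equation on $\Omega$. Moreover, $(*)$ has the following classical solutions. (1) For every $c>0$, on all of $\mathbb R^2$, $$\phi(x,t)=\ln\left\{-\frac c2\,\mathrm{sech}^2\left[\frac{\sqrt c}{2}(x-ct)\right]\right\}.$$ (2) For all $N\ge 1$, all real $\xi_1\ge\xi_2\ge\dots\ge\xi_N>0$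 and all nonzero real $\beta_1,\dots,\beta_N$, $$\phi(x,t)=\ln\left\{-2\frac{\partial^2}{\partial x^2}\ln\det A(x,t)\right\},\qquad A_{nm}(x,t)=\delta_{nm}+\frac{\beta_n\exp(8\xi_n^3t)\exp[-(\xi_n+\xi_m)x]}{\xi_n+\xi_m},$$ on its natural domain, that is, on the open set of all $(x,t)$ with $\det A(x,t)\ne0$ and $\frac{\partial^2}{\partial x^2}\ln\det A(x,t)\neq0$. If all $\beta_n$ are positive, this domain is all of $\mathbb R^2$. (3) On all of $\mathbb R^2$, $$\phi(x,t)=\ln\left\{-12\,\frac{3+4\cosh(8t-2x)+\cosh(64t-4x)}{[\cosh(36t-3x)+3\cosh(28t-x)]^2}\right\}.$$ -/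

import Mathlib

noncomputable section

namespace LogKdV

/-- The partial derivative `∂f/∂x` of a complex-valued function `f (x, t)` of two real variables. -/
def dx (f : ℝ → ℝ → ℂ) : ℝ → ℝ → ℂ := fun x t => deriv (fun y => f y t) x

/-- The partial derivative `∂f/∂t` of a complex-valued function `f (x, t)` of two real variables. -/
def dt (f : ℝ → ℝ → ℂ) : ℝ → ℝ → ℂ := fun x t => deriv (fun s => f x s) t

/-- `u` is a classical solution, on the open set `Ω` of points `(x, t)`, of the Korteweg--de Vries
equation `u_t + u_xxx - 6 u u_x = 0`. -/
def SolvesKdVOn (Ω : Set (ℝ × ℝ)) (u : ℝ → ℝ → ℂ) : Prop :=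
  IsOpen Ω ∧ ContDiffOn ℝ 3 (fun p : ℝ × ℝ => u p.1 p.2) Ω ∧
    ∀ x t : ℝ, (x, t) ∈ Ω →
      dt u x t + dx (dx (dx u)) x t - 6 * u x t * dx u x t = 0

/-- `φ` is a classical solution, on the open set `Ω` of points `(x, t)`, of the equation
`φ_t + φ_x ^ 3 + 3 φ_x φ_xx + φ_xxx - 6 e ^ φ φ_x = 0`. -/
def SolvesLogKdVOn (Ω : Set (ℝ × ℝ)) (φ : ℝ → ℝ → ℂ) : Prop :=
  IsOpen Ω ∧ ContDiffOn ℝ 3 (fun p : ℝ × ℝ => φ p.1 p.2) Ω ∧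
    ∀ x t : ℝ, (x, t) ∈ Ω →
      dt φ x t + dx φ x t ^ 3 + 3 * dx φ x t * dx (dx φ) x t + dx (dx (dx φ)) x t
        - 6 * Complex.exp (φ x t) * dx φ x t = 0

/-- The one-soliton of velocity `c`: `-(c / 2) sech² (√c / 2 (x - c t))`. -/
def oneSoliton (c : ℝ) (x t : ℝ) : ℝ :=
  -(c / 2) * (1 / Real.cosh (Real.sqrt c / 2 * (x - c * t))) ^ 2

/-- The matrix `A (x, t)` with the entries
`δ_nm + β_n exp (8 ξ_n³ t) exp (-(ξ_n + ξ_m) x) / (ξ_n + ξ_m)`. -/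
def solitonMatrix {N : ℕ} (ξ β : Fin N → ℝ) (x t : ℝ) : Matrix (Fin N) (Fin N) ℝ :=
  Matrix.of fun n m =>
    (if n = m then 1 else 0) +
      β n * Real.exp (8 * ξ n ^ 3 * t) * Real.exp (-(ξ n + ξ m) * x) / (ξ n + ξ m)

/-- The N-soliton `-2 ∂²/∂x² ln det A (x, t)`; `ln` is the principal complex logarithm, since
`det A` takes negative values for some choices of the `β_n`. -/
def nSoliton {N : ℕ} (ξ β : Fin N → ℝ) (x t : ℝ) : ℂ :=
  -2 * dx (dx fun y s => Complex.log ((solitonMatrix ξ β y s).det : ℂ)) x t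

/-- The natural domain of `ln (-2 ∂²/∂x² ln det A)`: the points at which both logarithms have a
nonzero argument. -/
def nSolitonDomain {N : ℕ} (ξ β : Fin N → ℝ) : Set (ℝ × ℝ) :=
  {p | (solitonMatrix ξ β p.1 p.2).det ≠ 0 ∧ nSoliton ξ β p.1 p.2 ≠ 0}

/-- The bisoliton with the initial profile `-6 sech² x`. -/
def bisoliton (x t : ℝ) : ℝ :=
  -12 * ((3 + 4 * Real.cosh (8 * t - 2 * x) + Real.cosh (64 * t - 4 * x)) /
    (Real.cosh (36 * t - 3 * x) + 3 * Real.cosh (28 * t - x)) ^ 2)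

end LogKdV

end

/-! For `u = exp φ`, the KdV expression in `u` is `exp φ` times the left side of the equation for
`φ`, and the exponential never vanishes; this is the equivalence. It remains to solve KdV by real
functions `q` without zeros: near each point `q` keeps its sign, so `Complex.log q` is smooth there
in spite of the branch cut, and `exp (log q) = q`.

Up to diagonal factors, `A` is a symmetric matrix `S` with `∂S/∂x = -e eᵀ` and with `∂S/∂t` a
combination of products of the vectors `Ξ^k e`. Hence the moments `m_ij = ⟨Ξ^i e, S⁻¹ Ξ^j e⟩` have
derivatives polynomial in the moments. Jacobi's formula gives `∂/∂x ln det A = -m_00`, so the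
N-soliton is `-4 m_10 + 2 m_00²`, and KdV becomes a polynomial identity that holds modulo
`moment_relation`, the trace left by the commutator of `Ξ²` and `S`.

For positive `β` the identity `dotProduct_symmMatrix_mulVec` makes `S` invertible and the N-soliton
negative everywhere. The one-soliton and the bisoliton are the cases `N = 1` and `N = 2` with
suitable positive `β`. -/

namespace LogKdV

open Filter Topology

/-! ### Exponentials and logarithms of solutions -/

section Calculus

theorem contDiffAt_deriv_of_succ {f : ℝ → ℂ} {x : ℝ} {n : ℕ}
    (hf : ContDiffAt ℝ ((n + 1 : ℕ) : WithTop ℕ∞) f x) :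
    ContDiffAt ℝ (n : WithTop ℕ∞) (deriv f) x := by
  have h := hf.fderiv_right (m := (n : WithTop ℕ∞)) (by norm_cast)
  exact h.clm_apply contDiffAt_const

/-- The first and third derivatives of the exponential of a function. -/
theorem deriv_cexp_comp {f : ℝ → ℂ} {x : ℝ} (hf : ContDiffAt ℝ 3 f x) :
    deriv (fun y => Complex.exp (f y)) x = deriv f x * Complex.exp (f x) ∧
    deriv (deriv (deriv fun y => Complex.exp (f y))) x =
      (deriv f x ^ 3 + 3 * deriv f x * deriv (deriv f) x + deriv (deriv (deriv f)) x) *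
        Complex.exp (f x) := by
  have e0 : ∀ᶠ y in 𝓝 x, ContDiffAt ℝ 3 f y := hf.eventually (by norm_num)
  have k0 : ∀ y, ContDiffAt ℝ 3 f y → HasDerivAt f (deriv f y) y := fun y h =>
    (h.differentiableAt (by norm_num)).hasDerivAt
  have c1 : ∀ y, ContDiffAt ℝ 3 f y → ContDiffAt ℝ 2 (deriv f) y := fun y h =>
    contDiffAt_deriv_of_succ (n := 2) h
  have c2 : ∀ y, ContDiffAt ℝ 3 f y → ContDiffAt ℝ 1 (deriv (deriv f)) y := fun y h =>
    contDiffAt_deriv_of_succ (n := 1) (by simpa using c1 y h)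
  have k1 : ∀ y, ContDiffAt ℝ 3 f y → HasDerivAt (deriv f) (deriv (deriv f) y) y := fun y h =>
    ((c1 y h).differentiableAt (by norm_num)).hasDerivAt
  have k2 : ∀ y, ContDiffAt ℝ 3 f y →
      HasDerivAt (deriv (deriv f)) (deriv (deriv (deriv f)) y) y := fun y h =>
    ((c2 y h).differentiableAt (by norm_num)).hasDerivAt
  have d1 : ∀ y, ContDiffAt ℝ 3 f y →
      deriv (fun y => Complex.exp (f y)) y = deriv f y * Complex.exp (f y) := fun y h => by
    rw [(k0 y h).cexp.deriv, mul_comm]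
  have d2 : ∀ y, ContDiffAt ℝ 3 f y →
      deriv (deriv (fun y => Complex.exp (f y))) y =
        (deriv (deriv f) y + deriv f y ^ 2) * Complex.exp (f y) := fun y h => by
    have : deriv (fun y => Complex.exp (f y)) =ᶠ[𝓝 y] fun y => deriv f y * Complex.exp (f y) :=
      (h.eventually (by norm_num)).mono d1
    rw [this.deriv_eq, ((k1 y h).fun_mul (k0 y h).cexp).deriv]
    ring
  refine ⟨d1 x hf, ?_⟩
  have : deriv (deriv fun y => Complex.exp (f y)) =ᶠ[𝓝 x]
      fun y => (deriv (deriv f) y + deriv f y ^ 2) * Complex.exp (f y) := e0.mono d2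
  rw [this.deriv_eq,
    (((k2 x hf).fun_add ((k1 x hf).fun_pow 2)).fun_mul (k0 x hf).cexp).deriv]
  push_cast
  ring

theorem contDiffAt_slice_x {Ω : Set (ℝ × ℝ)} {f : ℝ → ℝ → ℂ} (hΩ : IsOpen Ω)
    (hf : ContDiffOn ℝ 3 (fun p : ℝ × ℝ => f p.1 p.2) Ω) {x t : ℝ} (h : (x, t) ∈ Ω) :
    ContDiffAt ℝ 3 (fun y => f y t) x :=
  (hf.contDiffAt (hΩ.mem_nhds h)).comp x (f := fun y : ℝ => (y, t))
    (contDiffAt_id.prodMk contDiffAt_const)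

theorem contDiffAt_slice_t {Ω : Set (ℝ × ℝ)} {f : ℝ → ℝ → ℂ} (hΩ : IsOpen Ω)
    (hf : ContDiffOn ℝ 3 (fun p : ℝ × ℝ => f p.1 p.2) Ω) {x t : ℝ} (h : (x, t) ∈ Ω) :
    ContDiffAt ℝ 3 (fun s => f x s) t :=
  (hf.contDiffAt (hΩ.mem_nhds h)).comp t (f := fun s : ℝ => (x, s))
    (contDiffAt_const.prodMk contDiffAt_id)

theorem solvesLogKdVOn_iff {Ω : Set (ℝ × ℝ)} {φ : ℝ → ℝ → ℂ} (hΩ : IsOpen Ω)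
    (hφ : ContDiffOn ℝ 3 (fun p : ℝ × ℝ => φ p.1 p.2) Ω) :
    SolvesLogKdVOn Ω φ ↔ SolvesKdVOn Ω (fun x t => Complex.exp (φ x t)) := by
  have key : ∀ x t : ℝ, (x, t) ∈ Ω →
      dt (fun x t => Complex.exp (φ x t)) x t +
        dx (dx (dx (fun x t => Complex.exp (φ x t)))) x t -
        6 * Complex.exp (φ x t) * dx (fun x t => Complex.exp (φ x t)) x t =
      (dt φ x t + dx φ x t ^ 3 + 3 * dx φ x t * dx (dx φ) x t + dx (dx (dx φ)) x t
        - 6 * Complex.exp (φ x t) * dx φ x t) * Complex.exp (φ x t) := by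
    intro x t h
    obtain ⟨h1, h3⟩ := deriv_cexp_comp (contDiffAt_slice_x hΩ hφ h)
    obtain ⟨ht, -⟩ := deriv_cexp_comp (contDiffAt_slice_t hΩ hφ h)
    change deriv (fun s => Complex.exp (φ x s)) t +
      deriv (deriv (deriv fun y => Complex.exp (φ y t))) x -
      6 * Complex.exp (φ x t) * deriv (fun y => Complex.exp (φ y t)) x =
      (deriv (fun s => φ x s) t + deriv (fun y => φ y t) x ^ 3 +
        3 * deriv (fun y => φ y t) x * deriv (deriv fun y => φ y t) x +
        deriv (deriv (deriv fun y => φ y t)) x -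
        6 * Complex.exp (φ x t) * deriv (fun y => φ y t) x) * Complex.exp (φ x t)
    rw [h1, h3, ht]
    ring
  constructor
  · rintro ⟨-, -, h⟩
    exact ⟨hΩ, hφ.cexp, fun x t hx => by rw [key x t hx, h x t hx, zero_mul]⟩
  · rintro ⟨-, -, h⟩
    refine ⟨hΩ, hφ, fun x t hx => ?_⟩
    have := h x t hx
    rw [key x t hx] at this
    exact (mul_eq_zero.mp this).resolve_right (Complex.exp_ne_zero _)

/-- Openness of `Ω` turns equality on `Ω` into equality near each of its points, which all
derivatives respect; values off `Ω` play no role. -/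
theorem SolvesKdVOn.congr {Ω : Set (ℝ × ℝ)} {u v : ℝ → ℝ → ℂ} (hu : SolvesKdVOn Ω u)
    (h : ∀ x t, (x, t) ∈ Ω → v x t = u x t) : SolvesKdVOn Ω v := by
  obtain ⟨hΩ, hc, he⟩ := hu
  have ex : ∀ x t, (x, t) ∈ Ω → (fun y => v y t) =ᶠ[𝓝 x] fun y => u y t := fun x t hx => by
    have : ∀ᶠ y in 𝓝 x, (y, t) ∈ Ω :=
      (Continuous.prodMk_left t).continuousAt.eventually (hΩ.mem_nhds hx)
    exact this.mono fun y hy => h y t hy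
  have et : ∀ x t, (x, t) ∈ Ω → (fun s => v x s) =ᶠ[𝓝 t] fun s => u x s := fun x t hx => by
    have : ∀ᶠ s in 𝓝 t, (x, s) ∈ Ω :=
      (Continuous.prodMk_right x).continuousAt.eventually (hΩ.mem_nhds hx)
    exact this.mono fun s hs => h x s hs
  refine ⟨hΩ, hc.congr fun p hp => h p.1 p.2 hp, fun x t hx => ?_⟩
  rw [← he x t hx, h x t hx]
  have h1 : dx v x t = dx u x t := (ex x t hx).deriv_eq
  have h2 : dt v x t = dt u x t := (et x t hx).deriv_eq
  have h3 : dx (dx (dx v)) x t = dx (dx (dx u)) x t := (ex x t hx).deriv.deriv.deriv_eq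
  rw [h1, h2, h3]

/-- On a negative or positive ray the principal logarithm of a real function is its real
logarithm up to a constant. -/
theorem clog_ofReal_eventuallyEq {α : Type*} [TopologicalSpace α] {g : α → ℝ} {p : α}
    (hg : ContinuousAt g p) (h : g p ≠ 0) :
    ∃ c : ℂ, (fun z => Complex.log (g z : ℂ)) =ᶠ[𝓝 p] fun z => ((Real.log (g z) : ℝ) : ℂ) + c := by
  rcases h.lt_or_gt with h | h
  · refine ⟨Real.pi * Complex.I, (hg.eventually (gt_mem_nhds h)).mono fun z hz => ?_⟩
    have hz' : g z < 0 := hz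
    apply Complex.ext
    · simp [Complex.log_re]
    · simp [Complex.log_im, Complex.arg_ofReal_of_neg hz']
  · refine ⟨0, (hg.eventually (lt_mem_nhds h)).mono fun z hz => ?_⟩
    have hz' : 0 < g z := hz
    simp [Complex.ofReal_log hz'.le]

theorem hasDerivAt_clog_ofReal {g : ℝ → ℝ} {g' x : ℝ} (hg : HasDerivAt g g' x) (h : g x ≠ 0) :
    HasDerivAt (fun y => Complex.log (g y : ℂ)) ((g' / g x : ℝ) : ℂ) x := by
  obtain ⟨c, hc⟩ := clog_ofReal_eventuallyEq hg.continuousAt h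
  exact (((hg.log h).ofReal_comp).add_const c).congr_of_eventuallyEq hc

theorem solvesLogKdVOn_log_ofReal {Ω : Set (ℝ × ℝ)} {q : ℝ → ℝ → ℝ}
    (hq : ContDiffOn ℝ 3 (fun p : ℝ × ℝ => q p.1 p.2) Ω)
    (hu : SolvesKdVOn Ω fun x t => (q x t : ℂ))
    (h0 : ∀ x t, (x, t) ∈ Ω → q x t ≠ 0) :
    SolvesLogKdVOn Ω fun x t => Complex.log (q x t : ℂ) := by
  have hΩ := hu.1
  refine (solvesLogKdVOn_iff hΩ ?_).2 (hu.congr fun x t hx => Complex.exp_log ?_)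
  · intro p hp
    have hp' := hq.contDiffAt (hΩ.mem_nhds hp)
    obtain ⟨c, hc⟩ := clog_ofReal_eventuallyEq hp'.continuousAt (h0 p.1 p.2 hp)
    have : ContDiffAt ℝ 3 (fun z : ℝ × ℝ => ((Real.log (q z.1 z.2) : ℝ) : ℂ) + c) p :=
      ((Complex.ofRealCLM.contDiff.contDiffAt.comp p (hp'.log (h0 p.1 p.2 hp)))).add
        contDiffAt_const
    exact (this.congr_of_eventuallyEq hc).contDiffWithinAt
  · exact_mod_cast h0 x t hx

end Calculus

/-! ### Derivatives of determinants and inverses -/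

section MatrixCalculus

open Matrix

variable {n : Type*} [Fintype n]

theorem hasDerivAt_dotProduct_mulVec {R : ℝ → Matrix n n ℝ} {R' : Matrix n n ℝ}
    {a b : ℝ → n → ℝ} {a' b' : n → ℝ} {x : ℝ}
    (hR : ∀ i j, HasDerivAt (fun y => R y i j) (R' i j) x)
    (ha : ∀ i, HasDerivAt (fun y => a y i) (a' i) x)
    (hb : ∀ i, HasDerivAt (fun y => b y i) (b' i) x) :
    HasDerivAt (fun y => a y ⬝ᵥ R y *ᵥ b y)
      (a' ⬝ᵥ R x *ᵥ b x + a x ⬝ᵥ R' *ᵥ b x + a x ⬝ᵥ R x *ᵥ b') x := by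
  have := HasDerivAt.fun_sum (u := Finset.univ) fun i _ => (ha i).fun_mul
    (HasDerivAt.fun_sum (u := Finset.univ) fun j _ => (hR i j).fun_mul (hb j))
  refine this.congr_deriv ?_
  simp only [dotProduct, mulVec, Finset.sum_add_distrib, mul_add, add_assoc]

/-- A rank-one factor splits the bilinear form; this is what turns derivatives of moments into
products of moments. -/
theorem dotProduct_mul_vecMulVec_mul_mulVec (R : Matrix n n ℝ) (a b u v : n → ℝ) :
    a ⬝ᵥ (R * vecMulVec u v * R) *ᵥ b = (a ⬝ᵥ R *ᵥ u) * (v ⬝ᵥ R *ᵥ b) := by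
  rw [mul_vecMulVec, vecMulVec_mul, vecMulVec_mulVec, dotProduct_smul, ← dotProduct_mulVec]
  simp [mul_comm]

variable [DecidableEq n]

/-- Jacobi's formula. -/
theorem hasDerivAt_det {M : ℝ → Matrix n n ℝ} {M' : Matrix n n ℝ} {x : ℝ}
    (h : ∀ i j, HasDerivAt (fun y => M y i j) (M' i j) x) :
    HasDerivAt (fun y => (M y).det) ((M x).adjugate * M').trace x := by
  have h1 : HasDerivAt (fun y => ∑ σ : Equiv.Perm n, ((Equiv.Perm.sign σ : ℤ) : ℝ) *
      ∏ i, M y (σ i) i)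
      (∑ σ : Equiv.Perm n, ((Equiv.Perm.sign σ : ℤ) : ℝ) *
        ∑ i, (∏ j ∈ Finset.univ.erase i, M x (σ j) j) * M' (σ i) i) x := by
    refine HasDerivAt.fun_sum fun σ _ => HasDerivAt.const_mul _ ?_
    simpa using HasDerivAt.fun_finsetProd (u := Finset.univ) fun i _ => h (σ i) i
  simp only [← det_apply'] at h1
  refine h1.congr_deriv ?_
  simp only [Finset.mul_sum]
  rw [Finset.sum_comm, trace]
  refine Finset.sum_congr rfl fun i _ => ?_
  -- By Cramer's rule, a diagonal entry is the determinant with one column differentiated.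
  have : ((M x).adjugate * M').diag i = ((M x).updateCol i (fun k => M' k i)).det := by
    rw [← cramer_apply, cramer_eq_adjugate_mulVec]
    rfl
  rw [this, det_apply']
  refine Finset.sum_congr rfl fun σ _ => ?_
  rw [← Finset.mul_prod_erase _ _ (Finset.mem_univ i)]
  congr 1
  rw [mul_comm, updateCol_self]
  congr 1
  refine Finset.prod_congr rfl fun j hj => ?_
  rw [updateCol_ne (Finset.ne_of_mem_erase hj)]

theorem contDiffAt_det {E : Type*} [NormedAddCommGroup E] [NormedSpace ℝ E] {k : WithTop ℕ∞}
    {M : E → Matrix n n ℝ} {p : E} (h : ∀ i j, ContDiffAt ℝ k (fun z => M z i j) p) :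
    ContDiffAt ℝ k (fun z => (M z).det) p := by
  simp only [det_apply']
  exact ContDiffAt.sum fun σ _ => contDiffAt_const.mul (contDiffAt_prod fun i _ => h _ _)

/-- By Cramer's rule an entry of the inverse is a quotient of two determinants. -/
theorem contDiffAt_inv_apply {E : Type*} [NormedAddCommGroup E] [NormedSpace ℝ E]
    {k : WithTop ℕ∞} {M : E → Matrix n n ℝ} {p : E}
    (h : ∀ i j, ContDiffAt ℝ k (fun z => M z i j) p) (h0 : (M p).det ≠ 0) (i j : n) :
    ContDiffAt ℝ k (fun z => (M z)⁻¹ i j) p := by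
  have : (fun z => (M z)⁻¹ i j) =
      fun z => (M z).det⁻¹ * ((M z).updateRow j (Pi.single i 1)).det := by
    funext z
    rw [inv_def, Matrix.smul_apply, adjugate_apply, Ring.inverse_eq_inv', smul_eq_mul]
  rw [this]
  refine ((contDiffAt_det h).inv h0).mul (contDiffAt_det fun a b => ?_)
  by_cases hab : a = j
  · simpa [hab] using contDiffAt_const
  · simpa [updateRow_ne hab] using h a b

theorem hasDerivAt_inv_apply {M : ℝ → Matrix n n ℝ} {M' : Matrix n n ℝ} {x : ℝ}
    (h : ∀ i j, HasDerivAt (fun y => M y i j) (M' i j) x)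
    (hM : ∀ i j, ContDiffAt ℝ 1 (fun y => M y i j) x)
    (h0 : (M x).det ≠ 0) (i j : n) :
    HasDerivAt (fun y => (M y)⁻¹ i j) ((-((M x)⁻¹ * M' * (M x)⁻¹)) i j) x := by
  let D : Matrix n n ℝ := of fun i j => deriv (fun y => (M y)⁻¹ i j) x
  have hD : ∀ i j, HasDerivAt (fun y => (M y)⁻¹ i j) (D i j) x := fun i j =>
    ((contDiffAt_inv_apply hM h0 i j).differentiableAt (by norm_num)).hasDerivAt
  have hu : IsUnit (M x).det := isUnit_iff_ne_zero.2 h0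
  have hev : ∀ᶠ y in 𝓝 x, (M y).det ≠ 0 :=
    (contDiffAt_det hM).continuousAt.eventually_ne h0
  -- Differentiate `M M⁻¹ = 1`, which holds near `x`, entry by entry.
  have hz : M' * (M x)⁻¹ + M x * D = 0 := by
    ext a b
    have h1 : HasDerivAt (fun y => ∑ k, M y a k * (M y)⁻¹ k b)
        (∑ k, (M' a k * (M x)⁻¹ k b + M x a k * D k b)) x :=
      HasDerivAt.fun_sum fun k _ => (h a k).fun_mul (hD k b)
    have h2 : (fun y => ∑ k, M y a k * (M y)⁻¹ k b) =ᶠ[𝓝 x] fun _ => (1 : Matrix n n ℝ) a b :=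
      hev.mono fun y hy => by
        beta_reduce
        rw [← Matrix.mul_apply, mul_nonsing_inv _ (isUnit_iff_ne_zero.2 hy)]
    have h3 := h1.unique ((hasDerivAt_const x _).congr_of_eventuallyEq h2)
    simpa [Matrix.add_apply, Matrix.mul_apply, Finset.sum_add_distrib] using h3
  have : D = -((M x)⁻¹ * M' * (M x)⁻¹) := by
    have h4 : (M x)⁻¹ * (M' * (M x)⁻¹ + M x * D) = 0 := by rw [hz, mul_zero]
    rw [mul_add, ← mul_assoc, ← mul_assoc, nonsing_inv_mul _ hu, one_mul] at h4
    exact (neg_eq_of_add_eq_zero_right h4).symm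
  rw [← this]
  exact hD i j

end MatrixCalculus

end LogKdV

noncomputable section

namespace LogKdV

open Filter Topology Matrix

/-! ### The symmetric matrix and its moments -/

section Soliton

variable {N : ℕ} (ξ β : Fin N → ℝ)

/-- The vector with the entries `ξ_n ^ k exp (4 ξ_n³ t - ξ_n x)`. -/
def expVec (k : ℕ) (x t : ℝ) : Fin N → ℝ :=
  fun n => ξ n ^ k * Real.exp (4 * ξ n ^ 3 * t - ξ n * x)

/-- A symmetric matrix equivalent to `solitonMatrix`. -/
def symmMatrix (x t : ℝ) : Matrix (Fin N) (Fin N) ℝ :=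
  of fun n m => (if n = m then (β n)⁻¹ else 0) +
    expVec ξ 0 x t n * expVec ξ 0 x t m / (ξ n + ξ m)

/-- The moments `⟨Ξ^i e, S⁻¹ Ξ^j e⟩`, where `S = symmMatrix ξ β`, `e = expVec ξ 0` and `Ξ` is the
diagonal matrix with the entries `ξ`. -/
def moment (i j : ℕ) (x t : ℝ) : ℝ :=
  expVec ξ i x t ⬝ᵥ (symmMatrix ξ β x t)⁻¹ *ᵥ expVec ξ j x t

/-- The `N`-soliton as a polynomial in the moments. -/
def realSoliton (x t : ℝ) : ℝ :=
  -4 * moment ξ β 1 0 x t + 2 * moment ξ β 0 0 x t ^ 2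

/-- Splitting `exp (8 ξ_n³ t)` into two equal factors and moving one across by a diagonal
conjugation symmetrises the exponential part; `β_n` comes out of row `n`. -/
theorem det_solitonMatrix (hβ : ∀ n, β n ≠ 0) (x t : ℝ) :
    (solitonMatrix ξ β x t).det = (∏ n, β n) * (symmMatrix ξ β x t).det := by
  have h : solitonMatrix ξ β x t =
      diagonal (fun n => β n * Real.exp (4 * ξ n ^ 3 * t)) * symmMatrix ξ β x t *
        diagonal (fun n => (Real.exp (4 * ξ n ^ 3 * t))⁻¹) := by
    ext n m
    rw [mul_diagonal, diagonal_mul]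
    simp only [solitonMatrix, symmMatrix, of_apply, expVec, pow_zero, one_mul]
    have h1 : Real.exp (8 * ξ n ^ 3 * t) = Real.exp (4 * ξ n ^ 3 * t) ^ 2 := by
      rw [← Real.exp_nat_mul]; congr 1; push_cast; ring
    have h2 : Real.exp (-(ξ n + ξ m) * x) = (Real.exp (ξ n * x))⁻¹ * (Real.exp (ξ m * x))⁻¹ := by
      rw [← Real.exp_neg, ← Real.exp_neg, ← Real.exp_add]; congr 1; ring
    rw [h1, h2, Real.exp_sub, Real.exp_sub]
    have e1 := Real.exp_ne_zero (4 * ξ n ^ 3 * t)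
    have e2 := Real.exp_ne_zero (4 * ξ m ^ 3 * t)
    have hb := hβ n
    by_cases hnm : n = m
    · subst hnm
      simp only [if_true]
      field_simp
    · simp only [hnm, if_false, zero_add]
      field_simp
  rw [h, det_mul, det_mul, det_diagonal, det_diagonal, Finset.prod_mul_distrib,
    Finset.prod_inv_distrib]
  have : (∏ n, Real.exp (4 * ξ n ^ 3 * t)) ≠ 0 :=
    Finset.prod_ne_zero_iff.2 fun n _ => Real.exp_ne_zero _
  rw [mul_right_comm, mul_assoc (∏ n, β n), mul_inv_cancel₀ this, mul_one]

theorem symmMatrix_isSymm (x t : ℝ) : (symmMatrix ξ β x t).IsSymm := by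
  ext n m
  simp only [symmMatrix, transpose_apply, of_apply]
  rw [add_comm (ξ m), mul_comm (expVec ξ 0 x t m)]
  by_cases h : n = m
  · simp [h]
  · simp [h, Ne.symm h]

/-- The inverse of a symmetric matrix is symmetric. This lets each moment be named with its larger
index first, so that `ring` can match them. -/
theorem moment_comm (i j : ℕ) (x t : ℝ) : moment ξ β i j x t = moment ξ β j i x t := by
  have h : ((symmMatrix ξ β x t)⁻¹)ᵀ = (symmMatrix ξ β x t)⁻¹ := by
    rw [transpose_nonsing_inv, (symmMatrix_isSymm ξ β x t).eq]
  unfold moment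
  rw [dotProduct_mulVec, ← mulVec_transpose, h, dotProduct_comm]

theorem contDiff_expVec (k : ℕ) (n : Fin N) :
    ContDiff ℝ 3 fun p : ℝ × ℝ => expVec ξ k p.1 p.2 n := by
  unfold expVec
  fun_prop

theorem contDiff_symmMatrix (n m : Fin N) :
    ContDiff ℝ 3 fun p : ℝ × ℝ => symmMatrix ξ β p.1 p.2 n m := by
  simp only [symmMatrix, of_apply]
  exact contDiff_const.add (((contDiff_expVec ξ 0 n).mul (contDiff_expVec ξ 0 m)).div_const _)

theorem contDiffAt_moment (i j : ℕ) {p : ℝ × ℝ} (h : (symmMatrix ξ β p.1 p.2).det ≠ 0) :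
    ContDiffAt ℝ 3 (fun p : ℝ × ℝ => moment ξ β i j p.1 p.2) p := by
  simp only [moment, dotProduct, mulVec]
  exact ContDiffAt.sum fun n _ => (contDiff_expVec ξ i n).contDiffAt.mul
    (ContDiffAt.sum fun m _ => (contDiffAt_inv_apply
      (M := fun p : ℝ × ℝ => symmMatrix ξ β p.1 p.2)
      (fun a b => (contDiff_symmMatrix ξ β a b).contDiffAt) h n m).mul
        (contDiff_expVec ξ j m).contDiffAt)

theorem contDiffAt_realSoliton {p : ℝ × ℝ} (h : (symmMatrix ξ β p.1 p.2).det ≠ 0) :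
    ContDiffAt ℝ 3 (fun p : ℝ × ℝ => realSoliton ξ β p.1 p.2) p :=
  (contDiffAt_const.mul (contDiffAt_moment ξ β 1 0 h)).add
    (contDiffAt_const.mul ((contDiffAt_moment ξ β 0 0 h).pow 2))

theorem hasDerivAt_expVec_x (k : ℕ) (x t : ℝ) (n : Fin N) :
    HasDerivAt (fun y => expVec ξ k y t n) ((-expVec ξ (k + 1) x t) n) x := by
  have := ((((hasDerivAt_id x).const_mul (ξ n)).const_sub (4 * ξ n ^ 3 * t)).exp).const_mul
    (ξ n ^ k)
  refine this.congr_deriv ?_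
  simp only [expVec, Pi.neg_apply, id]
  ring

theorem hasDerivAt_expVec_t (k : ℕ) (x t : ℝ) (n : Fin N) :
    HasDerivAt (fun s => expVec ξ k x s n) (((4 : ℝ) • expVec ξ (k + 3) x t) n) t := by
  have := ((((hasDerivAt_id t).const_mul (4 * ξ n ^ 3)).sub_const (ξ n * x)).exp).const_mul
    (ξ n ^ k)
  refine this.congr_deriv ?_
  simp only [expVec, Pi.smul_apply, id, smul_eq_mul]
  ring

variable {ξ}

/-- The factor `-(ξ_n + ξ_m)` from the exponentials cancels the denominator. -/
theorem hasDerivAt_symmMatrix_x (hξ : ∀ n, 0 < ξ n) (x t : ℝ) (n m : Fin N) :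
    HasDerivAt (fun y => symmMatrix ξ β y t n m)
      ((-vecMulVec (expVec ξ 0 x t) (expVec ξ 0 x t)) n m) x := by
  have h := (((hasDerivAt_expVec_x ξ 0 x t n).fun_mul (hasDerivAt_expVec_x ξ 0 x t m)).div_const
    (ξ n + ξ m)).const_add (if n = m then (β n)⁻¹ else 0)
  refine h.congr_deriv ?_
  have : ξ n + ξ m ≠ 0 := (add_pos (hξ n) (hξ m)).ne'
  simp only [vecMulVec_apply, Matrix.neg_apply, Pi.neg_apply, expVec]
  field_simp
  ring

/-- Here `a³ + b³ = (a + b) (a² - a b + b²)` cancels the denominator. -/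
theorem hasDerivAt_symmMatrix_t (hξ : ∀ n, 0 < ξ n) (x t : ℝ) (n m : Fin N) :
    HasDerivAt (fun s => symmMatrix ξ β x s n m)
      (((4 : ℝ) • (vecMulVec (expVec ξ 2 x t) (expVec ξ 0 x t) -
        vecMulVec (expVec ξ 1 x t) (expVec ξ 1 x t) +
        vecMulVec (expVec ξ 0 x t) (expVec ξ 2 x t))) n m) t := by
  have h := (((hasDerivAt_expVec_t ξ 0 x t n).fun_mul (hasDerivAt_expVec_t ξ 0 x t m)).div_const
    (ξ n + ξ m)).const_add (if n = m then (β n)⁻¹ else 0)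
  refine h.congr_deriv ?_
  have : ξ n + ξ m ≠ 0 := (add_pos (hξ n) (hξ m)).ne'
  simp only [vecMulVec_apply, Matrix.smul_apply, Matrix.add_apply, Matrix.sub_apply,
    Pi.smul_apply, expVec, smul_eq_mul]
  field_simp
  ring

variable {β}

theorem hasDerivAt_moment_x (hξ : ∀ n, 0 < ξ n) {x t : ℝ} (h : (symmMatrix ξ β x t).det ≠ 0)
    (i j : ℕ) :
    HasDerivAt (fun y => moment ξ β i j y t)
      (-moment ξ β (i + 1) j x t - moment ξ β i (j + 1) x t +
        moment ξ β i 0 x t * moment ξ β 0 j x t) x := by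
  have hR := hasDerivAt_inv_apply (M := fun y => symmMatrix ξ β y t)
    (hasDerivAt_symmMatrix_x β hξ x t)
    (fun n m => (((contDiff_symmMatrix ξ β n m).of_le (by norm_num)).comp
      (contDiff_id.prodMk contDiff_const : ContDiff ℝ 1 fun y : ℝ => (y, t))).contDiffAt) h
  have := hasDerivAt_dotProduct_mulVec hR (hasDerivAt_expVec_x ξ i x t)
    (hasDerivAt_expVec_x ξ j x t)
  refine this.congr_deriv ?_
  rw [mul_neg, neg_mul, neg_neg, dotProduct_mul_vecMulVec_mul_mulVec, neg_dotProduct, mulVec_neg,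
    dotProduct_neg]
  simp only [moment]
  ring

theorem hasDerivAt_moment_t (hξ : ∀ n, 0 < ξ n) {x t : ℝ} (h : (symmMatrix ξ β x t).det ≠ 0)
    (i j : ℕ) :
    HasDerivAt (fun s => moment ξ β i j x s)
      (4 * (moment ξ β (i + 3) j x t + moment ξ β i (j + 3) x t) -
        4 * (moment ξ β i 2 x t * moment ξ β 0 j x t - moment ξ β i 1 x t * moment ξ β 1 j x t +
          moment ξ β i 0 x t * moment ξ β 2 j x t)) t := by
  have hR := hasDerivAt_inv_apply (M := fun s => symmMatrix ξ β x s)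
    (hasDerivAt_symmMatrix_t β hξ x t)
    (fun n m => (((contDiff_symmMatrix ξ β n m).of_le (by norm_num)).comp
      (contDiff_const.prodMk contDiff_id : ContDiff ℝ 1 fun s : ℝ => (x, s))).contDiffAt) h
  have := hasDerivAt_dotProduct_mulVec hR (hasDerivAt_expVec_t ξ i x t)
    (hasDerivAt_expVec_t ξ j x t)
  refine this.congr_deriv ?_
  rw [mul_smul_comm, smul_mul_assoc, mul_add, mul_sub, add_mul, sub_mul, neg_mulVec, smul_mulVec,
    add_mulVec, sub_mulVec, dotProduct_neg, dotProduct_smul, dotProduct_add, dotProduct_sub,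
    dotProduct_mul_vecMulVec_mul_mulVec, dotProduct_mul_vecMulVec_mul_mulVec,
    dotProduct_mul_vecMulVec_mul_mulVec, smul_dotProduct, mulVec_smul, dotProduct_smul]
  simp only [moment, smul_eq_mul]
  ring

/-- Since `(ξ_n² - ξ_m²) / (ξ_n + ξ_m) = ξ_n - ξ_m`, the commutator of `Ξ²` with `S` has rank at
most two; multiplying by `S⁻¹` on both sides and pairing with `Ξ^i e` and `Ξ^j e` gives the
relation. -/
theorem moment_relation (hξ : ∀ n, 0 < ξ n) {x t : ℝ} (h : (symmMatrix ξ β x t).det ≠ 0)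
    (i j : ℕ) :
    moment ξ β i (j + 2) x t - moment ξ β (i + 2) j x t =
      moment ξ β i 1 x t * moment ξ β 0 j x t - moment ξ β i 0 x t * moment ξ β 1 j x t := by
  set S := symmMatrix ξ β x t with hS
  let D : Matrix (Fin N) (Fin N) ℝ := diagonal fun n => ξ n ^ 2
  have hu : IsUnit S.det := isUnit_iff_ne_zero.2 h
  have hc : D * S - S * D = vecMulVec (expVec ξ 1 x t) (expVec ξ 0 x t) -
      vecMulVec (expVec ξ 0 x t) (expVec ξ 1 x t) := by
    ext n m
    rw [Matrix.sub_apply, Matrix.sub_apply, diagonal_mul, mul_diagonal]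
    simp only [hS, symmMatrix, of_apply, vecMulVec_apply, expVec]
    have : ξ n + ξ m ≠ 0 := (add_pos (hξ n) (hξ m)).ne'
    by_cases hnm : n = m
    · subst hnm
      simp only [if_true]
      ring
    · simp only [hnm, if_false, zero_add]
      field_simp
      ring
  have hR : S⁻¹ * D - D * S⁻¹ = S⁻¹ * vecMulVec (expVec ξ 1 x t) (expVec ξ 0 x t) * S⁻¹ -
      S⁻¹ * vecMulVec (expVec ξ 0 x t) (expVec ξ 1 x t) * S⁻¹ := by
    rw [← sub_mul, ← mul_sub, ← hc, mul_sub, sub_mul]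
    congr 1
    · rw [mul_assoc, mul_assoc, mul_nonsing_inv _ hu, mul_one]
    · rw [← mul_assoc, nonsing_inv_mul _ hu, one_mul]
  have hD : ∀ k, D *ᵥ expVec ξ k x t = expVec ξ (k + 2) x t := fun k => by
    ext n
    rw [mulVec_diagonal]
    simp only [expVec]
    ring
  have hD' : ∀ k, expVec ξ k x t ᵥ* D = expVec ξ (k + 2) x t := fun k => by
    ext n
    rw [vecMul_diagonal]
    simp only [expVec]
    ring
  have := congrArg (fun M => expVec ξ i x t ⬝ᵥ M *ᵥ expVec ξ j x t) hR
  simp only [sub_mulVec, dotProduct_sub, dotProduct_mul_vecMulVec_mul_mulVec] at this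
  rw [← mulVec_mulVec, ← mulVec_mulVec, hD, dotProduct_mulVec _ D, hD'] at this
  exact this

end Soliton

end LogKdV

end

namespace LogKdV

open Filter Topology Matrix

/-! ### The N-soliton: KdV, natural domain, positivity -/

section NSoliton

variable {N : ℕ} {ξ β : Fin N → ℝ}

theorem isOpen_det_symmMatrix_ne_zero :
    IsOpen {p : ℝ × ℝ | (symmMatrix ξ β p.1 p.2).det ≠ 0} := by
  have : Continuous fun p : ℝ × ℝ => (symmMatrix ξ β p.1 p.2).det :=
    Continuous.matrix_det (continuous_matrix fun i j => (contDiff_symmMatrix ξ β i j).continuous)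
  exact isOpen_ne_fun this continuous_const

theorem eventually_det_symmMatrix_ne_zero {x t : ℝ} (h : (symmMatrix ξ β x t).det ≠ 0) :
    ∀ᶠ y in 𝓝 x, (symmMatrix ξ β y t).det ≠ 0 :=
  (Continuous.prodMk_left t).continuousAt.eventually
    ((isOpen_det_symmMatrix_ne_zero (ξ := ξ) (β := β)).mem_nhds
      (show (x, t) ∈ {p : ℝ × ℝ | (symmMatrix ξ β p.1 p.2).det ≠ 0} from h))

theorem realSoliton_deriv_x (hξ : ∀ n, 0 < ξ n) {x t : ℝ} (h : (symmMatrix ξ β x t).det ≠ 0) :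
    HasDerivAt (fun y => realSoliton ξ β y t)
      (4 * moment ξ β 2 0 x t + 4 * moment ξ β 1 1 x t
        - 12 * moment ξ β 1 0 x t * moment ξ β 0 0 x t + 4 * moment ξ β 0 0 x t ^ 3) x := by
  have d := hasDerivAt_moment_x hξ h
  refine (((d 1 0).const_mul (-4)).fun_add (((d 0 0).fun_pow 2).const_mul 2)).congr_deriv ?_
  rw [moment_comm ξ β 0 1]
  push_cast
  ring

theorem realSoliton_deriv_xx (hξ : ∀ n, 0 < ξ n) {x t : ℝ} (h : (symmMatrix ξ β x t).det ≠ 0) :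
    HasDerivAt (fun y => 4 * moment ξ β 2 0 y t + 4 * moment ξ β 1 1 y t
        - 12 * moment ξ β 1 0 y t * moment ξ β 0 0 y t + 4 * moment ξ β 0 0 y t ^ 3)
      (-4 * moment ξ β 3 0 x t - 12 * moment ξ β 2 1 x t
        + 16 * moment ξ β 2 0 x t * moment ξ β 0 0 x t + 28 * moment ξ β 1 0 x t ^ 2
        + 12 * moment ξ β 1 1 x t * moment ξ β 0 0 x t
        - 48 * moment ξ β 1 0 x t * moment ξ β 0 0 x t ^ 2 + 12 * moment ξ β 0 0 x t ^ 4) x := by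
  have d := hasDerivAt_moment_x hξ h
  refine (((((d 2 0).const_mul 4).fun_add ((d 1 1).const_mul 4)).fun_sub
    (((d 1 0).const_mul 12).fun_mul (d 0 0))).fun_add
      (((d 0 0).fun_pow 3).const_mul 4)).congr_deriv ?_
  rw [moment_comm ξ β 0 1, moment_comm ξ β 1 2]
  push_cast
  ring

/-- The value is arranged as `6 u u_x - u_t`, with `u_t` as in `realSoliton_deriv_t`, so that KdV is
immediate. -/
theorem realSoliton_deriv_xxx (hξ : ∀ n, 0 < ξ n) {x t : ℝ} (h : (symmMatrix ξ β x t).det ≠ 0) :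
    HasDerivAt (fun y => -4 * moment ξ β 3 0 y t - 12 * moment ξ β 2 1 y t
        + 16 * moment ξ β 2 0 y t * moment ξ β 0 0 y t + 28 * moment ξ β 1 0 y t ^ 2
        + 12 * moment ξ β 1 1 y t * moment ξ β 0 0 y t
        - 48 * moment ξ β 1 0 y t * moment ξ β 0 0 y t ^ 2 + 12 * moment ξ β 0 0 y t ^ 4)
      (6 * realSoliton ξ β x t * (4 * moment ξ β 2 0 x t + 4 * moment ξ β 1 1 x t
        - 12 * moment ξ β 1 0 x t * moment ξ β 0 0 x t + 4 * moment ξ β 0 0 x t ^ 3)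
        - (-4 * (4 * (moment ξ β 4 0 x t + moment ξ β 3 1 x t)
          - 4 * (moment ξ β 2 1 x t * moment ξ β 0 0 x t
            - moment ξ β 1 1 x t * moment ξ β 1 0 x t
            + moment ξ β 1 0 x t * moment ξ β 2 0 x t))
          + 4 * moment ξ β 0 0 x t * (8 * moment ξ β 3 0 x t
            - 8 * moment ξ β 2 0 x t * moment ξ β 0 0 x t + 4 * moment ξ β 1 0 x t ^ 2))) x := by
  have d := hasDerivAt_moment_x hξ h
  refine (((((((d 3 0).const_mul (-4)).fun_sub ((d 2 1).const_mul 12)).fun_add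
    (((d 2 0).const_mul 16).fun_mul (d 0 0))).fun_add (((d 1 0).fun_pow 2).const_mul 28)).fun_add
    (((d 1 1).const_mul 12).fun_mul (d 0 0))).fun_sub
    (((d 1 0).const_mul 48).fun_mul ((d 0 0).fun_pow 2))).fun_add
    (((d 0 0).fun_pow 4).const_mul 12) |>.congr_deriv ?_
  -- These relations eliminate the difference of `m_12` and `m_30`, and that of `m_22` and `m_40`.
  have r1 := moment_relation hξ h 1 0
  have r2 := moment_relation hξ h 2 0
  rw [moment_comm ξ β 1 (0 + 2)] at r1
  simp only [zero_add, Nat.reduceAdd, moment_comm ξ β 0 1, moment_comm ξ β 1 2, realSoliton] at *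
  push_cast
  linear_combination 12 * r2 - 12 * moment ξ β 0 0 x t * r1

theorem realSoliton_deriv_t (hξ : ∀ n, 0 < ξ n) {x t : ℝ} (h : (symmMatrix ξ β x t).det ≠ 0) :
    HasDerivAt (fun s => realSoliton ξ β x s)
      (-4 * (4 * (moment ξ β 4 0 x t + moment ξ β 3 1 x t)
          - 4 * (moment ξ β 2 1 x t * moment ξ β 0 0 x t
            - moment ξ β 1 1 x t * moment ξ β 1 0 x t
            + moment ξ β 1 0 x t * moment ξ β 2 0 x t))
          + 4 * moment ξ β 0 0 x t * (8 * moment ξ β 3 0 x t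
            - 8 * moment ξ β 2 0 x t * moment ξ β 0 0 x t + 4 * moment ξ β 1 0 x t ^ 2)) t := by
  have d := hasDerivAt_moment_t hξ h
  refine (((d 1 0).const_mul (-4)).fun_add (((d 0 0).fun_pow 2).const_mul 2)).congr_deriv ?_
  simp only [zero_add, Nat.reduceAdd, moment_comm ξ β 0 1, moment_comm ξ β 0 2,
    moment_comm ξ β 0 3, moment_comm ξ β 1 2, moment_comm ξ β 1 3]
  push_cast
  ring

/-- A formula for a derivative must hold near a point to be differentiated again, hence the open
condition `P`. -/
theorem deriv_deriv_deriv_ofReal {f f₁ f₂ : ℝ → ℝ} {P : ℝ → Prop} {x f₃ : ℝ}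
    (hP : ∀ y, P y → ∀ᶠ z in 𝓝 y, P z) (h1 : ∀ y, P y → HasDerivAt f (f₁ y) y)
    (h2 : ∀ y, P y → HasDerivAt f₁ (f₂ y) y) (hx : P x) (h3 : HasDerivAt f₂ f₃ x) :
    deriv (deriv (deriv fun y => (f y : ℂ))) x = f₃ := by
  have e1 : ∀ y, P y → deriv (fun y => (f y : ℂ)) y = f₁ y := fun y hy =>
    (h1 y hy).ofReal_comp.deriv
  have e2 : ∀ y, P y → deriv (deriv fun y => (f y : ℂ)) y = f₂ y := fun y hy => by
    rw [EventuallyEq.deriv_eq ((hP y hy).mono e1), (h2 y hy).ofReal_comp.deriv]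
  rw [EventuallyEq.deriv_eq ((hP x hx).mono e2), h3.ofReal_comp.deriv]

theorem solvesKdVOn_realSoliton (hξ : ∀ n, 0 < ξ n) {Ω : Set (ℝ × ℝ)} (hΩ : IsOpen Ω)
    (h : ∀ p ∈ Ω, (symmMatrix ξ β p.1 p.2).det ≠ 0) :
    SolvesKdVOn Ω fun x t => (realSoliton ξ β x t : ℂ) := by
  refine ⟨hΩ, fun p hp => ?_, fun x t hx => ?_⟩
  · exact (Complex.ofRealCLM.contDiff.contDiffAt.comp p
      (contDiffAt_realSoliton ξ β (h p hp))).contDiffWithinAt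
  · have h0 : (symmMatrix ξ β x t).det ≠ 0 := h (x, t) hx
    have e1 : deriv (fun y => (realSoliton ξ β y t : ℂ)) x = _ :=
      (realSoliton_deriv_x hξ h0).ofReal_comp.deriv
    have e3 := deriv_deriv_deriv_ofReal (P := fun y => (symmMatrix ξ β y t).det ≠ 0)
      (fun y hy => eventually_det_symmMatrix_ne_zero hy) (fun y hy => realSoliton_deriv_x hξ hy)
      (fun y hy => realSoliton_deriv_xx hξ hy) h0 (realSoliton_deriv_xxx hξ h0)
    have e4 : deriv (fun s => (realSoliton ξ β x s : ℂ)) t = _ :=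
      (realSoliton_deriv_t hξ h0).ofReal_comp.deriv
    change deriv (fun s => (realSoliton ξ β x s : ℂ)) t +
      deriv (deriv (deriv fun y => (realSoliton ξ β y t : ℂ))) x -
      6 * (realSoliton ξ β x t : ℂ) * deriv (fun y => (realSoliton ξ β y t : ℂ)) x = 0
    rw [e4, e3, e1]
    push_cast
    ring

/-- The constant `∏ β_n` drops out of the logarithmic derivative, and the trace of `S⁻¹ e eᵀ` is
`m_00`. -/
theorem hasDerivAt_log_det_solitonMatrix (hξ : ∀ n, 0 < ξ n) (hβ : ∀ n, β n ≠ 0) {x t : ℝ}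
    (h : (symmMatrix ξ β x t).det ≠ 0) :
    HasDerivAt (fun y => Complex.log ((solitonMatrix ξ β y t).det : ℂ))
      ((-moment ξ β 0 0 x t : ℝ) : ℂ) x := by
  have hp : (∏ n, β n) ≠ 0 := Finset.prod_ne_zero_iff.2 fun n _ => hβ n
  have hd := (hasDerivAt_det (M := fun y => symmMatrix ξ β y t)
    (hasDerivAt_symmMatrix_x β hξ x t)).const_mul (∏ n, β n)
  simp only [← det_solitonMatrix ξ β hβ] at hd
  have h0 : (solitonMatrix ξ β x t).det ≠ 0 := by
    rw [det_solitonMatrix ξ β hβ]; exact mul_ne_zero hp h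
  convert! hasDerivAt_clog_ofReal hd h0 using 2
  rw [det_solitonMatrix ξ β hβ, mul_div_mul_left _ _ hp, moment, inv_def, Ring.inverse_eq_inv',
    mul_neg, trace_neg, mul_vecMulVec, trace_vecMulVec, smul_mulVec, dotProduct_smul,
    dotProduct_comm, smul_eq_mul]
  field_simp

theorem nSoliton_eq_realSoliton (hξ : ∀ n, 0 < ξ n) (hβ : ∀ n, β n ≠ 0) {x t : ℝ}
    (h : (symmMatrix ξ β x t).det ≠ 0) : nSoliton ξ β x t = realSoliton ξ β x t := by
  have h1 : (deriv fun y => Complex.log ((solitonMatrix ξ β y t).det : ℂ)) =ᶠ[𝓝 x]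
      fun y => ((-moment ξ β 0 0 y t : ℝ) : ℂ) :=
    (eventually_det_symmMatrix_ne_zero h).mono fun y hy =>
      (hasDerivAt_log_det_solitonMatrix hξ hβ hy).deriv
  change -2 * deriv (deriv fun y => Complex.log ((solitonMatrix ξ β y t).det : ℂ)) x = _
  rw [h1.deriv_eq, (hasDerivAt_moment_x hξ h 0 0).fun_neg.ofReal_comp.deriv,
    moment_comm ξ β 0, realSoliton]
  push_cast
  ring

theorem det_solitonMatrix_ne_zero_iff (hβ : ∀ n, β n ≠ 0) {x t : ℝ} :
    (solitonMatrix ξ β x t).det ≠ 0 ↔ (symmMatrix ξ β x t).det ≠ 0 := by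
  have hp : (∏ n, β n) ≠ 0 := Finset.prod_ne_zero_iff.2 fun n _ => hβ n
  rw [det_solitonMatrix ξ β hβ, mul_ne_zero_iff, and_iff_right hp]

theorem nSolitonDomain_eq (hξ : ∀ n, 0 < ξ n) (hβ : ∀ n, β n ≠ 0) :
    nSolitonDomain ξ β =
      {p | (symmMatrix ξ β p.1 p.2).det ≠ 0} ∩ {p | realSoliton ξ β p.1 p.2 ≠ 0} := by
  ext p
  simp only [nSolitonDomain, Set.mem_ofPred_eq, Set.mem_inter_iff,
    det_solitonMatrix_ne_zero_iff hβ]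
  refine and_congr_right fun h => ?_
  rw [nSoliton_eq_realSoliton hξ hβ h, Complex.ofReal_ne_zero]

theorem isOpen_nSolitonDomain (hξ : ∀ n, 0 < ξ n) (hβ : ∀ n, β n ≠ 0) :
    IsOpen (nSolitonDomain ξ β) := by
  rw [nSolitonDomain_eq hξ hβ]
  exact ContinuousOn.isOpen_inter_preimage
    (fun p hp => (contDiffAt_realSoliton ξ β hp).continuousAt.continuousWithinAt)
    isOpen_det_symmMatrix_ne_zero isOpen_compl_singleton

theorem solvesLogKdVOn_log_nSoliton (hξ : ∀ n, 0 < ξ n) (hβ : ∀ n, β n ≠ 0) :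
    SolvesLogKdVOn (nSolitonDomain ξ β) fun x t => Complex.log (nSoliton ξ β x t) := by
  have hmem : ∀ p ∈ nSolitonDomain ξ β,
      (symmMatrix ξ β p.1 p.2).det ≠ 0 ∧ realSoliton ξ β p.1 p.2 ≠ 0 := fun p hp => by
    rwa [nSolitonDomain_eq hξ hβ] at hp
  have hΩ := isOpen_nSolitonDomain hξ hβ
  have hs := solvesLogKdVOn_log_ofReal (q := realSoliton ξ β)
    (fun p hp => (contDiffAt_realSoliton ξ β (hmem p hp).1).contDiffWithinAt)
    (solvesKdVOn_realSoliton hξ hΩ fun p hp => (hmem p hp).1) fun x t hx => (hmem _ hx).2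
  have heq : ∀ x t, (x, t) ∈ nSolitonDomain ξ β →
      Complex.log (nSoliton ξ β x t) = Complex.log (realSoliton ξ β x t : ℂ) := fun x t hx => by
    rw [nSoliton_eq_realSoliton hξ hβ (hmem _ hx).1]
  have hc := hs.2.1.congr (f₁ := fun p : ℝ × ℝ => Complex.log (nSoliton ξ β p.1 p.2))
    fun p hp => heq p.1 p.2 hp
  -- Going through KdV makes `SolvesKdVOn.congr` applicable.
  refine (solvesLogKdVOn_iff hΩ hc).2
    (((solvesLogKdVOn_iff hΩ hs.2.1).1 hs).congr fun x t hx => ?_)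
  rw [heq x t hx]

/-- The weight `ξ_n` on one side is the point: symmetrising `ξ_n / (ξ_n + ξ_m)` in `n` and `m` gives
a constant, so the double sum becomes a square. -/
theorem dotProduct_symmMatrix_mulVec (hξ : ∀ n, 0 < ξ n) (x t : ℝ) (v : Fin N → ℝ) :
    2 * ((fun n => ξ n * v n) ⬝ᵥ symmMatrix ξ β x t *ᵥ v) =
      (expVec ξ 0 x t ⬝ᵥ v) ^ 2 + 2 * ∑ n, ξ n * (β n)⁻¹ * v n ^ 2 := by
  set e := expVec ξ 0 x t with he
  have h1 : (fun n => ξ n * v n) ⬝ᵥ symmMatrix ξ β x t *ᵥ v =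
      ∑ n, ξ n * (β n)⁻¹ * v n ^ 2 +
        ∑ n, ∑ m, ξ n / (ξ n + ξ m) * (e n * v n * (e m * v m)) := by
    simp only [dotProduct, mulVec, symmMatrix, of_apply, add_mul, Finset.sum_add_distrib, mul_add,
      ite_mul, zero_mul, Finset.sum_ite_eq, Finset.mem_univ, if_true, Finset.mul_sum]
    congr 1
    · exact Finset.sum_congr rfl fun n _ => by ring
    · exact Finset.sum_congr rfl fun n _ => Finset.sum_congr rfl fun m _ => by ring
  have h2 : ∑ n, ∑ m, ξ n / (ξ n + ξ m) * (e n * v n * (e m * v m)) =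
      ∑ n, ∑ m, ξ m / (ξ n + ξ m) * (e n * v n * (e m * v m)) := by
    rw [Finset.sum_comm]
    exact Finset.sum_congr rfl fun n _ => Finset.sum_congr rfl fun m _ => by
      rw [add_comm (ξ m)]; ring
  have h3 : ∑ n, ∑ m, ξ n / (ξ n + ξ m) * (e n * v n * (e m * v m)) +
      ∑ n, ∑ m, ξ m / (ξ n + ξ m) * (e n * v n * (e m * v m)) = (e ⬝ᵥ v) ^ 2 := by
    simp only [← Finset.sum_add_distrib]
    rw [sq, dotProduct, Finset.sum_mul_sum]
    refine Finset.sum_congr rfl fun n _ => Finset.sum_congr rfl fun m _ => ?_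
    have : ξ n + ξ m ≠ 0 := (add_pos (hξ n) (hξ m)).ne'
    field_simp
  rw [h1]
  linarith

theorem sum_weighted_sq_pos (hξ : ∀ n, 0 < ξ n) (hβ : ∀ n, 0 < β n) {v : Fin N → ℝ} (hv : v ≠ 0) :
    0 < ∑ n, ξ n * (β n)⁻¹ * v n ^ 2 := by
  obtain ⟨k, hk⟩ := Function.ne_iff.1 hv
  have hc : ∀ n, 0 < ξ n * (β n)⁻¹ := fun n => mul_pos (hξ n) (inv_pos.2 (hβ n))
  exact Finset.sum_pos' (fun n _ => mul_nonneg (hc n).le (sq_nonneg _))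
    ⟨k, Finset.mem_univ k, mul_pos (hc k) (sq_pos_of_ne_zero hk)⟩

theorem det_symmMatrix_ne_zero (hξ : ∀ n, 0 < ξ n) (hβ : ∀ n, 0 < β n) (x t : ℝ) :
    (symmMatrix ξ β x t).det ≠ 0 := by
  intro h
  obtain ⟨v, hv, hz⟩ := exists_mulVec_eq_zero_iff.2 h
  have h1 := dotProduct_symmMatrix_mulVec (β := β) hξ x t v
  rw [hz, dotProduct_zero] at h1
  nlinarith [sum_weighted_sq_pos hξ hβ hv, sq_nonneg (expVec ξ 0 x t ⬝ᵥ v)]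

/-- For `v = S⁻¹ e` the quadratic identity reads `2 m_10 = m_00² + 2 ∑ ξ_n v_n² / β_n`, so the
soliton equals `-4 ∑ ξ_n v_n² / β_n`. -/
theorem realSoliton_neg (hN : 1 ≤ N) (hξ : ∀ n, 0 < ξ n) (hβ : ∀ n, 0 < β n) (x t : ℝ) :
    realSoliton ξ β x t < 0 := by
  have hu : IsUnit (symmMatrix ξ β x t).det :=
    isUnit_iff_ne_zero.2 (det_symmMatrix_ne_zero hξ hβ x t)
  set v := (symmMatrix ξ β x t)⁻¹ *ᵥ expVec ξ 0 x t with hv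
  have hSv : symmMatrix ξ β x t *ᵥ v = expVec ξ 0 x t := by
    rw [hv, mulVec_mulVec, mul_nonsing_inv _ hu, one_mulVec]
  have hv0 : v ≠ 0 := by
    intro h
    rw [h, mulVec_zero] at hSv
    -- The entries of `e` are positive, and `1 ≤ N` provides one.
    have := congrFun hSv ⟨0, hN⟩
    simp [expVec, (Real.exp_pos _).ne] at this
  have h1 := dotProduct_symmMatrix_mulVec (β := β) hξ x t v
  have h2 : (fun n => ξ n * v n) ⬝ᵥ symmMatrix ξ β x t *ᵥ v = moment ξ β 1 0 x t := by
    rw [hSv, moment, ← hv]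
    simp only [dotProduct, expVec]
    exact Finset.sum_congr rfl fun n _ => by ring
  have h3 : expVec ξ 0 x t ⬝ᵥ v = moment ξ β 0 0 x t := rfl
  rw [h2, h3] at h1
  have := sum_weighted_sq_pos hξ hβ hv0
  rw [realSoliton]
  linarith

theorem nSolitonDomain_eq_univ (hN : 1 ≤ N) (hξ : ∀ n, 0 < ξ n) (hβ : ∀ n, 0 < β n) :
    nSolitonDomain ξ β = Set.univ := by
  rw [nSolitonDomain_eq hξ fun n => (hβ n).ne']
  exact Set.eq_univ_of_forall fun p =>
    ⟨det_symmMatrix_ne_zero hξ hβ p.1 p.2, (realSoliton_neg hN hξ hβ p.1 p.2).ne⟩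

/-- The `N`-soliton computed from any formula for the determinant. -/
theorem nSoliton_eq_of_det {τ τ₁ τ₂ : ℝ → ℝ} {t : ℝ}
    (hτ : ∀ y, (solitonMatrix ξ β y t).det = τ y) (h1 : ∀ y, HasDerivAt τ (τ₁ y) y)
    (h2 : ∀ y, HasDerivAt τ₁ (τ₂ y) y) (h0 : ∀ y, τ y ≠ 0) (x : ℝ) :
    nSoliton ξ β x t = ((-2 * ((τ₂ x * τ x - τ₁ x * τ₁ x) / τ x ^ 2) : ℝ) : ℂ) := by
  have e : (deriv fun y => Complex.log ((solitonMatrix ξ β y t).det : ℂ)) =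
      fun y => ((τ₁ y / τ y : ℝ) : ℂ) := by
    funext y
    simp only [hτ]
    exact (hasDerivAt_clog_ofReal (h1 y) (h0 y)).deriv
  change -2 * deriv (deriv fun y => Complex.log ((solitonMatrix ξ β y t).det : ℂ)) x = _
  rw [e, ((h2 x).fun_div (h1 x) (h0 x)).ofReal_comp.deriv]
  push_cast
  ring

end NSoliton

/-! ### The one-soliton and the bisoliton as N-solitons -/

section Examples

/-- With `ξ = √c / 2` one has `8 ξ³ = c √c`, the velocity `c`; `β = 2 ξ` reduces the determinant to
`1 + E`. -/
theorem oneSoliton_eq_nSoliton {c : ℝ} (hc : 0 < c) (x t : ℝ) :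
    (oneSoliton c x t : ℂ) =
      nSoliton (fun _ : Fin 1 => Real.sqrt c / 2) (fun _ => Real.sqrt c) x t := by
  have hs : 0 < Real.sqrt c := Real.sqrt_pos.2 hc
  set s := Real.sqrt c
  have hcs : c = s ^ 2 := (Real.sq_sqrt hc.le).symm
  let E : ℝ → ℝ := fun y => Real.exp (s * (c * t - y))
  have hE : ∀ y, HasDerivAt E (-s * E y) y := fun y =>
    ((((hasDerivAt_id y).const_sub (c * t)).const_mul s).exp).congr_deriv (by
      simp only [E, id]; ring)
  have hpos : ∀ y, 0 < E y := fun y => Real.exp_pos _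
  rw [nSoliton_eq_of_det (τ := fun y => 1 + E y) (τ₁ := fun y => -s * E y)
    (τ₂ := fun y => -s * (-s * E y)) _ (fun y => (hE y).const_add 1)
    (fun y => (hE y).const_mul _) (fun y => by have := hpos y; positivity)]
  · congr 1
    have hcosh : Real.cosh (s / 2 * (x - c * t)) ^ 2 = (1 + E x) ^ 2 / (4 * E x) := by
      have h1 : Real.exp (-(s / 2 * (x - c * t))) ^ 2 = E x := by
        simp only [E]
        rw [← Real.exp_nat_mul]; congr 1; push_cast; ring
      rw [Real.cosh_eq, ← h1, Real.exp_neg]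
      have := Real.exp_ne_zero (s / 2 * (x - c * t))
      field_simp
      ring
    have := hpos x
    rw [oneSoliton, one_div, inv_pow, hcosh, hcs]
    field_simp
    ring
  · intro y
    rw [det_fin_one]
    simp only [solitonMatrix, of_apply, if_true, E]
    rw [mul_assoc, ← Real.exp_add, add_halves, mul_div_cancel_left₀ _ hs.ne', hcs]
    congr 2
    ring

theorem bisoliton_eq_nSoliton (x t : ℝ) :
    (bisoliton x t : ℂ) = nSoliton ![2, 1] ![12, 6] x t := by
  let E : ℝ → ℝ := fun y => Real.exp (4 * t - y)
  let F : ℝ → ℝ := fun y => Real.exp (32 * t - 2 * y)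
  have hE : ∀ y, HasDerivAt E (-E y) y := fun y =>
    (((hasDerivAt_id y).const_sub (4 * t)).exp).congr_deriv (by simp only [E, id]; ring)
  have hF : ∀ y, HasDerivAt F (-2 * F y) y := fun y =>
    ((((hasDerivAt_id y).const_mul 2).const_sub (32 * t)).exp).congr_deriv (by
      simp only [F, id]; ring)
  have hEp : ∀ y, 0 < E y := fun y => Real.exp_pos _
  have hFp : ∀ y, 0 < F y := fun y => Real.exp_pos _
  have d : ∀ (a b c y : ℝ), HasDerivAt
      (fun y => a * E y ^ 2 + b * F y ^ 2 + c * (E y ^ 2 * F y ^ 2))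
      (-2 * a * E y ^ 2 + -4 * b * F y ^ 2 + -6 * c * (E y ^ 2 * F y ^ 2)) y := fun a b c y =>
    (((((hE y).fun_pow 2).const_mul a).fun_add (((hF y).fun_pow 2).const_mul b)).fun_add
      ((((hE y).fun_pow 2).fun_mul ((hF y).fun_pow 2)).const_mul c)).congr_deriv (by
        push_cast; ring)
  rw [nSoliton_eq_of_det
    -- The diagonal entries of `A` are `1 + 3 F²` and `1 + 3 E²`; the off-diagonal product is `8 E²
    -- F²`, leaving `9 - 8 = 1`.
    (τ := fun y => 1 + (3 * E y ^ 2 + 3 * F y ^ 2 + 1 * (E y ^ 2 * F y ^ 2)))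
    (τ₁ := fun y => -2 * 3 * E y ^ 2 + -4 * 3 * F y ^ 2 + -6 * 1 * (E y ^ 2 * F y ^ 2))
    (τ₂ := fun y => -2 * (-2 * 3) * E y ^ 2 + -4 * (-4 * 3) * F y ^ 2 +
      -6 * (-6 * 1) * (E y ^ 2 * F y ^ 2)) _ (fun y => (d _ _ _ y).const_add 1)
    (fun y => d _ _ _ y) (fun y => by positivity)]
  · congr 1
    have hE0 := hEp x
    have hF0 := hFp x
    have c1 : Real.cosh (8 * t - 2 * x) = (E x ^ 2 + (E x ^ 2)⁻¹) / 2 := by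
      rw [Real.cosh_eq, Real.exp_neg, show 8 * t - 2 * x = (2 : ℕ) * (4 * t - x) by push_cast; ring,
        Real.exp_nat_mul]
    have c2 : Real.cosh (64 * t - 4 * x) = (F x ^ 2 + (F x ^ 2)⁻¹) / 2 := by
      rw [Real.cosh_eq, Real.exp_neg,
        show 64 * t - 4 * x = (2 : ℕ) * (32 * t - 2 * x) by push_cast; ring, Real.exp_nat_mul]
    have c3 : Real.cosh (36 * t - 3 * x) = (E x * F x + (E x * F x)⁻¹) / 2 := by
      rw [Real.cosh_eq, Real.exp_neg,
        show 36 * t - 3 * x = (4 * t - x) + (32 * t - 2 * x) by ring, Real.exp_add]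
    have c4 : Real.cosh (28 * t - x) = (F x / E x + (F x / E x)⁻¹) / 2 := by
      rw [Real.cosh_eq, Real.exp_neg,
        show 28 * t - x = (32 * t - 2 * x) - (4 * t - x) by ring, Real.exp_sub]
    rw [bisoliton, c1, c2, c3, c4]
    generalize E x = a at *
    generalize F x = b at *
    -- The base of the squared denominator is `τ / (2 E F)`.
    have hs : (a * b + (a * b)⁻¹) / 2 + 3 * ((b / a + (b / a)⁻¹) / 2) =
        (1 + (3 * a ^ 2 + 3 * b ^ 2 + 1 * (a ^ 2 * b ^ 2))) / (2 * a * b) := by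
      field_simp
      ring
    rw [hs]
    field_simp
    ring
  · intro y
    rw [det_fin_two]
    simp only [solitonMatrix, of_apply, cons_val_zero, cons_val_one, if_true, E, F]
    have a1 : Real.exp (8 * (2 : ℝ) ^ 3 * t) * Real.exp (-(2 + 2) * y) =
        Real.exp (32 * t - 2 * y) ^ 2 := by
      rw [← Real.exp_add, ← Real.exp_nat_mul]; congr 1; push_cast; ring
    have a2 : Real.exp (8 * (1 : ℝ) ^ 3 * t) * Real.exp (-(1 + 1) * y) =
        Real.exp (4 * t - y) ^ 2 := by
      rw [← Real.exp_add, ← Real.exp_nat_mul]; congr 1; push_cast; ring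
    have a3 : Real.exp (-(2 + 1) * y) * Real.exp (-(1 + 2) * y) =
        Real.exp (-(2 + 2) * y) * Real.exp (-(1 + 1) * y) := by
      rw [← Real.exp_add, ← Real.exp_add]; congr 1; ring
    simp only [one_ne_zero, zero_ne_one, if_false, zero_add]
    rw [← a1, ← a2]
    linear_combination -8 * Real.exp (8 * (2 : ℝ) ^ 3 * t) * Real.exp (8 * (1 : ℝ) ^ 3 * t) * a3

end Examples

end LogKdV

theorem proposition26 :
    -- the equation is the transform of the Korteweg--de Vries equation under `u = exp φ`
    (∀ (Ω : Set (ℝ × ℝ)) (φ : ℝ → ℝ → ℂ), IsOpen Ω →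
      ContDiffOn ℝ 3 (fun p : ℝ × ℝ => φ p.1 p.2) Ω →
        (LogKdV.SolvesLogKdVOn Ω φ ↔
          LogKdV.SolvesKdVOn Ω (fun x t => Complex.exp (φ x t)))) ∧
    -- the logarithm of the one-soliton
    (∀ c : ℝ, 0 < c →
      LogKdV.SolvesLogKdVOn Set.univ
        (fun x t => Complex.log (LogKdV.oneSoliton c x t : ℂ))) ∧
    -- the logarithm of the N-soliton
    (∀ (N : ℕ) (ξ β : Fin N → ℝ), 1 ≤ N → Antitone ξ → (∀ n, 0 < ξ n) → (∀ n, β n ≠ 0) →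
      LogKdV.SolvesLogKdVOn (LogKdV.nSolitonDomain ξ β)
        (fun x t => Complex.log (LogKdV.nSoliton ξ β x t)) ∧
      ((∀ n, 0 < β n) → LogKdV.nSolitonDomain ξ β = Set.univ)) ∧
    -- the logarithm of the bisoliton
    LogKdV.SolvesLogKdVOn Set.univ
      (fun x t => Complex.log (LogKdV.bisoliton x t : ℂ)) := by
  refine ⟨fun Ω φ hΩ hφ => LogKdV.solvesLogKdVOn_iff hΩ hφ, fun c hc => ?_,
    fun N ξ β hN _ hξ hβ => ⟨LogKdV.solvesLogKdVOn_log_nSoliton hξ hβ,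
      fun hβ' => LogKdV.nSolitonDomain_eq_univ hN hξ hβ'⟩, ?_⟩
  · simp only [LogKdV.oneSoliton_eq_nSoliton hc]
    have hs : 0 < Real.sqrt c := Real.sqrt_pos.2 hc
    -- As `β` is positive, the whole plane is the natural domain.
    rw [← LogKdV.nSolitonDomain_eq_univ (ξ := fun _ : Fin 1 => Real.sqrt c / 2)
      (β := fun _ => Real.sqrt c) le_rfl (fun _ => half_pos hs) fun _ => hs]
    exact LogKdV.solvesLogKdVOn_log_nSoliton (fun _ => half_pos hs) fun _ => hs.ne'
  · simp only [LogKdV.bisoliton_eq_nSoliton]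
    have hξ : ∀ n, 0 < (![2, 1] : Fin 2 → ℝ) n := fun n => by fin_cases n <;> simp
    have hβ : ∀ n, 0 < (![12, 6] : Fin 2 → ℝ) n := fun n => by fin_cases n <;> simp
    rw [← LogKdV.nSolitonDomain_eq_univ one_le_two hξ hβ]
    exact LogKdV.solvesLogKdVOn_log_nSoliton hξ fun n => (hβ n).ne'
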